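/- Let $A$ be a (not necessarily unital) Banach algebra over $\mathbb{K}\in\{\mathbb{R},\mathbb{C}\}$. For $a,b\in A$, $f\in A^*$ and $m,n\in A^{**}$ define $f\cdot a,\ n\cdot f\in A^*$ and the first Arens product $m\cdot n\in A^{**}$ by $$\langle f\cdot a,b\rangle=\langle f,ab\rangle,\qquad \langle n\cdot f,a\rangle=\langle n,f\cdot a\rangle,\qquad \langle m\cdot n,f\rangle=\langle m,n\cdot f\rangle ,$$ so that $A^{**}$ is a Banach algebra, and let $$Z_1(A^{**})=\{m\in A^{**}:\ n\mapsto m\cdot n\ \text{ is weak}^*\text{-to-weak}^*\text{ continuous on } A^{**}\}.$$ Suppose that $A$ is left strongly Arens irregular, i.e. $Z_1(A^{**})$ equals the canonical image of $A$ in $A^{**}$, and that $A^{**}$ with the first Arens product is amenable, i.e. for every Banach $A^{**}$-bimodule $X$ every bounded linear $D:A^{**}\to X^*$ with $D(mn)=m\cdot D(n)+D(m)\cdot n$ for all $m,n$ is of the form $D(m)=m\cdot\varphi-\varphi\cdot m$ for some $\varphi\in X^*$. Then: (i) $A$ has a (two-sided) identity element. (ii) If moreover $A$ is a dual Banach algebra,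 i.e. there is a closed sub-bimodule $E$ of $A^*$ such that $A=E^*$ in the sense that the canonical map $A\to E^*$, $a\mapsto(f\mapsto f(a))$, is bijective (hence an isomorphism of Banach spaces), then $A$ is reflexive, i.e. the canonical embedding $A\to A^{**}$ is surjective. -/

import Mathlib

open NormedSpace

universe u v w

noncomputable section

/-! ### Banach bimodules, derivations, amenability

Banach algebras are not assumed to be unital: a Banach algebra over `𝕜` is a complete
`NonUnitalNormedRing` with a compatible `NormedSpace 𝕜` structure. -/

/-- A Banach `B`-bimodule structure on the normed space `X`: two jointly bounded bilinear actions,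
`lact b x = b · x` and `ract b x = x · b`, satisfying the (not necessarily unital) bimodule
identities. -/
structure BanachBimodule (𝕜 : Type v) [RCLike 𝕜] (B : Type w) [NonUnitalNormedRing B]
    [NormedSpace 𝕜 B] (X : Type u) [NormedAddCommGroup X] [NormedSpace 𝕜 X] where
  lact : B →L[𝕜] X →L[𝕜] X
  ract : B →L[𝕜] X →L[𝕜] X
  lact_mul : ∀ (a b : B) (x : X), lact (a * b) x = lact a (lact b x)
  ract_mul : ∀ (a b : B) (x : X), ract (a * b) x = ract b (ract a x)
  lact_ract : ∀ (a b : B) (x : X), lact a (ract b x) = ract b (lact a x)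

namespace BanachBimodule

variable {𝕜 : Type v} [RCLike 𝕜] {B : Type w} [NonUnitalNormedRing B] [NormedSpace 𝕜 B]
  {X : Type u} [NormedAddCommGroup X] [NormedSpace 𝕜 X]

/-- The dual bimodule `X*`: `⟨b · φ, x⟩ = ⟨φ, x · b⟩` and `⟨φ · b, x⟩ = ⟨φ, b · x⟩`. -/
def dual (M : BanachBimodule 𝕜 B X) : BanachBimodule 𝕜 B (StrongDual 𝕜 X) where
  lact := ((ContinuousLinearMap.compL 𝕜 X X 𝕜).flip).comp M.ract
  ract := ((ContinuousLinearMap.compL 𝕜 X X 𝕜).flip).comp M.lact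
  lact_mul a b φ := by ext x; simp [M.ract_mul]
  ract_mul a b φ := by ext x; simp [M.lact_mul]
  lact_ract a b φ := by ext x; simp [M.lact_ract]

@[simp] theorem dual_lact_apply (M : BanachBimodule 𝕜 B X) (b : B) (φ : StrongDual 𝕜 X) (x : X) :
    M.dual.lact b φ x = φ (M.ract b x) := rfl

@[simp] theorem dual_ract_apply (M : BanachBimodule 𝕜 B X) (b : B) (φ : StrongDual 𝕜 X) (x : X) :
    M.dual.ract b φ x = φ (M.lact b x) := rfl

/-- A bounded linear map `D : B → X` is a derivation if `D (ab) = a · D b + D a · b`. -/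
def IsDerivation (M : BanachBimodule 𝕜 B X) (D : B →L[𝕜] X) : Prop :=
  ∀ a b : B, D (a * b) = M.lact a (D b) + M.ract b (D a)

/-- `D : B → X` is inner if for some `x` one has `D a = a · x - x · a` for all `a`. -/
def IsInner (M : BanachBimodule 𝕜 B X) (D : B →L[𝕜] X) : Prop :=
  ∃ x : X, ∀ a : B, D a = M.lact a x - M.ract a x

end BanachBimodule

/-- The Banach algebra `B` is amenable: for every Banach `B`-bimodule `X`, every bounded derivation
from `B` into the dual bimodule `X*` is inner. -/
def IsAmenable (𝕜 : Type v) [RCLike 𝕜] (B : Type w) [NonUnitalNormedRing B]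
    [NormedSpace 𝕜 B] : Prop :=
  ∀ (X : Type w) [NormedAddCommGroup X] [NormedSpace 𝕜 X] [CompleteSpace X]
    (M : BanachBimodule 𝕜 B X) (D : B →L[𝕜] StrongDual 𝕜 X),
    M.dual.IsDerivation D → M.dual.IsInner D

/-! ### The first Arens product -/

section Arens

variable (𝕜 : Type v) [RCLike 𝕜] (A : Type u) [NonUnitalNormedRing A] [NormedSpace 𝕜 A]

/-- The second dual `A**`, as a type of its own so that it can carry the first Arens product. -/
def ArensBidual : Type (max u v) := StrongDual 𝕜 (StrongDual 𝕜 A)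

namespace ArensBidual

instance instNormedAddCommGroup : NormedAddCommGroup (ArensBidual 𝕜 A) :=
  inferInstanceAs (NormedAddCommGroup (StrongDual 𝕜 (StrongDual 𝕜 A)))

/-- The identification of `A**` with its underlying space of functionals on `A*`. -/
def toDual : ArensBidual 𝕜 A ≃ StrongDual 𝕜 (StrongDual 𝕜 A) := Equiv.refl _

variable [IsScalarTower 𝕜 A A] [SMulCommClass 𝕜 A A]

/-- `f · a ∈ A*` for `f ∈ A*` and `a ∈ A`: `⟨f · a, b⟩ = ⟨f, ab⟩`. -/
def functionalMul : StrongDual 𝕜 A →L[𝕜] A →L[𝕜] StrongDual 𝕜 A :=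
  ((ContinuousLinearMap.compL 𝕜 A (A →L[𝕜] A) (StrongDual 𝕜 A)).flip
    (ContinuousLinearMap.mul 𝕜 A)).comp (ContinuousLinearMap.compL 𝕜 A A 𝕜)

@[simp] theorem functionalMul_apply (f : StrongDual 𝕜 A) (a b : A) :
    functionalMul 𝕜 A f a b = f (a * b) := rfl

/-- `n · f ∈ A*` for `n ∈ A**` and `f ∈ A*`: `⟨n · f, a⟩ = ⟨n, f · a⟩`. -/
def bidualMul (n : StrongDual 𝕜 (StrongDual 𝕜 A)) : StrongDual 𝕜 A →L[𝕜] StrongDual 𝕜 A :=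
  (ContinuousLinearMap.compL 𝕜 A (StrongDual 𝕜 A) 𝕜 n).comp (functionalMul 𝕜 A)

@[simp] theorem bidualMul_apply (n : StrongDual 𝕜 (StrongDual 𝕜 A)) (f : StrongDual 𝕜 A) (a : A) :
    bidualMul 𝕜 A n f a = n (functionalMul 𝕜 A f a) := rfl

/-- The first Arens product: `⟨m · n, f⟩ = ⟨m, n · f⟩`. -/
instance instMul : Mul (ArensBidual 𝕜 A) where
  mul m n := (toDual 𝕜 A).symm ((toDual 𝕜 A m).comp (bidualMul 𝕜 A (toDual 𝕜 A n)))

theorem mul_apply (m n : ArensBidual 𝕜 A) (f : StrongDual 𝕜 A) :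
    toDual 𝕜 A (m * n) f = toDual 𝕜 A m (bidualMul 𝕜 A (toDual 𝕜 A n) f) := rfl

theorem norm_functionalMul_le (f : StrongDual 𝕜 A) (a : A) :
    ‖functionalMul 𝕜 A f a‖ ≤ ‖f‖ * ‖a‖ := by
  refine ContinuousLinearMap.opNorm_le_bound _ (by positivity) fun b => ?_
  rw [functionalMul_apply, mul_assoc]
  exact f.le_opNorm_of_le (norm_mul_le a b)

theorem norm_bidualMul_le (n : StrongDual 𝕜 (StrongDual 𝕜 A)) (f : StrongDual 𝕜 A) :
    ‖bidualMul 𝕜 A n f‖ ≤ ‖n‖ * ‖f‖ := by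
  refine ContinuousLinearMap.opNorm_le_bound _ (by positivity) fun a => ?_
  rw [bidualMul_apply, mul_assoc]
  exact n.le_opNorm_of_le (norm_functionalMul_le 𝕜 A f a)

/-- `A**` with the first Arens product and the dual norm is a normed ring. -/
instance instNonUnitalNormedRing : NonUnitalNormedRing (ArensBidual 𝕜 A) where
  __ := instNormedAddCommGroup 𝕜 A
  __ := instMul 𝕜 A
  left_distrib m n p := by
    apply (toDual 𝕜 A).injective
    ext f
    exact (congrArg (toDual 𝕜 A m) (show bidualMul 𝕜 A (toDual 𝕜 A (n + p)) f =
      bidualMul 𝕜 A (toDual 𝕜 A n) f + bidualMul 𝕜 A (toDual 𝕜 A p) f from rfl)).trans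
      (map_add (toDual 𝕜 A m) _ _)
  right_distrib m n p := rfl
  zero_mul m := rfl
  mul_zero m := by
    apply (toDual 𝕜 A).injective
    ext f
    exact (congrArg (toDual 𝕜 A m) (show bidualMul 𝕜 A (toDual 𝕜 A 0) f = 0 from rfl)).trans
      (map_zero (toDual 𝕜 A m))
  mul_assoc m n p := by
    apply (toDual 𝕜 A).injective
    ext f
    refine congrArg (toDual 𝕜 A m) ?_
    ext a
    refine congrArg (toDual 𝕜 A n) ?_
    ext b
    refine congrArg (toDual 𝕜 A p) ?_
    ext c
    simp [mul_assoc]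
  norm_mul_le m n := by
    refine ContinuousLinearMap.opNorm_le_bound
      (toDual 𝕜 A (m * n)) (by positivity) fun f => ?_
    rw [mul_apply, mul_assoc]
    exact (toDual 𝕜 A m).le_opNorm_of_le (norm_bidualMul_le 𝕜 A _ f)

instance instNormedSpace : NormedSpace 𝕜 (ArensBidual 𝕜 A) :=
  inferInstanceAs (NormedSpace 𝕜 (StrongDual 𝕜 (StrongDual 𝕜 A)))

instance instIsScalarTower : IsScalarTower 𝕜 (ArensBidual 𝕜 A) (ArensBidual 𝕜 A) where
  smul_assoc _ _ _ := rfl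

instance instSMulCommClass : SMulCommClass 𝕜 (ArensBidual 𝕜 A) (ArensBidual 𝕜 A) where
  smul_comm c m n := by
    apply (toDual 𝕜 A).injective
    ext f
    exact ((congrArg (toDual 𝕜 A m) (show bidualMul 𝕜 A (toDual 𝕜 A (c • n)) f =
      c • bidualMul 𝕜 A (toDual 𝕜 A n) f from rfl)).trans
      (map_smul (toDual 𝕜 A m) _ _)).symm

instance instCompleteSpace : CompleteSpace (ArensBidual 𝕜 A) :=
  inferInstanceAs (CompleteSpace (StrongDual 𝕜 (StrongDual 𝕜 A)))

/-- The first topological center `Z₁(A**)`: all `m ∈ A**` such that `n ↦ m · n` is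
weak*-to-weak* continuous on `A**`. -/
def firstTopologicalCenter : Set (ArensBidual 𝕜 A) :=
  {m | Continuous fun n : WeakDual 𝕜 (StrongDual 𝕜 A) =>
    StrongDual.toWeakDual
      (toDual 𝕜 A (m * (toDual 𝕜 A).symm (WeakDual.toStrongDual n)))}

end ArensBidual

variable [IsScalarTower 𝕜 A A] [SMulCommClass 𝕜 A A]

/-- `A` is left strongly Arens irregular: `Z₁(A**)` is the canonical image of `A` in `A**`. -/
def IsLeftStronglyArensIrregular : Prop :=
  ArensBidual.firstTopologicalCenter 𝕜 A =
    Set.range fun a : A => (ArensBidual.toDual 𝕜 A).symm (inclusionInDoubleDual 𝕜 A a)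

/-- `A` is a dual Banach algebra: there is a closed sub-bimodule `E` of `A*` such that `A = E*`,
i.e. such that the canonical map `A → E*`, `a ↦ (f ↦ f a)`, is bijective (it is then an isomorphism
of Banach spaces, `A` being complete). -/
def IsDualBanachAlgebra : Prop :=
  ∃ E : Submodule 𝕜 (StrongDual 𝕜 A),
    IsClosed (E : Set (StrongDual 𝕜 A)) ∧
    (∀ f ∈ E, ∀ a : A,
      f.comp (ContinuousLinearMap.mul 𝕜 A a) ∈ E ∧
      f.comp ((ContinuousLinearMap.mul 𝕜 A).flip a) ∈ E) ∧
    Function.Bijective fun a : A => (inclusionInDoubleDual 𝕜 A a).comp E.subtypeL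

end Arens

/-- The normed space `X` is reflexive: the canonical embedding `X → X**` is onto. -/
def IsReflexiveSpace (𝕜 : Type v) [RCLike 𝕜] (X : Type u) [NormedAddCommGroup X]
    [NormedSpace 𝕜 X] : Prop :=
  Function.Surjective (inclusionInDoubleDual 𝕜 X)

end

/-!
Write `B = A**` with the first Arens product. The whole argument rests on one fact
(`ArensBidual.exists_identity_ker`): if `B` is amenable and `P : B → B` is a bounded idempotent
algebra endomorphism whose kernel `I` is the annihilator of a set of functionals in `A*`, then the
ideal `I` has a two-sided identity.

To see this, let `Q = id - P : B → I`. It is a derivation for either of the two bimodule structures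
on `I` in which one of the actions is multiplication and the other is twisted by `P`, since
`Q (bc) = P b * Q c + Q b * c = b * Q c + Q b * P c`. Amenability makes `Q` inner in `I**`
(`IsAmenable.exists_bidual_eq`). With the twist on the left, this gives `Φ ∈ I**` with
`x = -Φ · x` for `x ∈ I`; restricting `Φ` to `A*` gives an element of `I`, because `I` is an
annihilator, and its negative `p` is a left identity of `I`. With the twist on the right, it gives
`Ψ ∈ I**` with `x = x · Ψ` for `x ∈ I`; then `Ψ = p · Ψ = p`, so that `p` is a right identity as
well.

For the existence of an identity in `A`, take `P = 0`: then `B` has an identity `p`, and `n ↦ p * n`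
is the identity map, so `p` lies in the first topological centre, which is `A`.

If `A = E*`, let `P` be the projection `A** → E* = A` given by restriction to `E`; its kernel is
`E^⊥`. The identity `p` of this ideal is central in `B`, so `n ↦ p * n = n * p` is weak*-continuous
and `p` lies in `A`. Hence `p = P p = 0`, so `ker P = 0` and every `m ∈ A**` equals `P m ∈ A`.
-/

noncomputable section

/-! ### Derivations into ideals of an amenable algebra -/

section Ideals

variable {𝕜 : Type v} [RCLike 𝕜] {B : Type (max u v)} [NonUnitalNormedRing B] [NormedSpace 𝕜 B]

/-- A bounded derivation of an amenable algebra into an arbitrary Banach bimodule `X` becomes inner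
in `X**`. -/
theorem IsAmenable.exists_bidual_eq (h : IsAmenable.{v, max u v} 𝕜 B)
    {X : Type (max u v)} [NormedAddCommGroup X] [NormedSpace 𝕜 X]
    (M : BanachBimodule 𝕜 B X) (D : B →L[𝕜] X) (hD : M.IsDerivation D) :
    ∃ Φ : StrongDual 𝕜 (StrongDual 𝕜 X), ∀ (b : B) (g : StrongDual 𝕜 X),
      g (D b) = Φ (g.comp (M.lact b)) - Φ (g.comp (M.ract b)) := by
  obtain ⟨Φ, hΦ⟩ := h (StrongDual 𝕜 X) M.dual ((inclusionInDoubleDual 𝕜 X).comp D) (by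
    intro a b
    ext g
    simp only [ContinuousLinearMap.comp_apply, hD a b, map_add, add_apply]
    rfl)
  exact ⟨Φ, fun b g => DFunLike.congr_fun (hΦ b) g⟩

/-- The complementary projection `id - P`, as a map onto the kernel of the idempotent `P`. -/
def kerProjection (P : B →L[𝕜] B) (hPP : ∀ b, P (P b) = P b) : B →L[𝕜] P.ker :=
  (ContinuousLinearMap.id 𝕜 B - P).codRestrict P.ker fun b => by
    simp [hPP]

theorem coe_kerProjection (P : B →L[𝕜] B) (hPP : ∀ b, P (P b) = P b) (b : B) :
    (kerProjection P hPP b : B) = b - P b := rfl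

theorem kerProjection_eq_self (P : B →L[𝕜] B) (hPP : ∀ b, P (P b) = P b) (x : P.ker) :
    kerProjection P hPP x = x :=
  Subtype.ext (by rw [coe_kerProjection, show P (x : B) = 0 from x.2, sub_zero])

theorem mul_mem_ker_left (P : B →L[𝕜] B) (hP : ∀ a b, P (a * b) = P a * P b) (b : B) :
    ∀ x ∈ P.ker, b * x ∈ P.ker := fun x hx => by
  change P (b * x) = 0
  rw [hP, show P x = 0 from hx, mul_zero]

theorem mul_mem_ker_right (P : B →L[𝕜] B) (hP : ∀ a b, P (a * b) = P a * P b) (b : B) :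
    ∀ x ∈ P.ker, x * b ∈ P.ker := fun x hx => by
  change P (x * b) = 0
  rw [hP, show P x = 0 from hx, zero_mul]

variable [IsScalarTower 𝕜 B B] [SMulCommClass 𝕜 B B]

/-- The bimodule structure on a two-sided ideal `I` with actions `b · x = S b * x` and
`x · b = x * T b`, where `S` and `T` are bounded algebra endomorphisms. -/
def BanachBimodule.ofIdeal (I : Submodule 𝕜 B) (hl : ∀ b, ∀ x ∈ I, b * x ∈ I)
    (hr : ∀ b, ∀ x ∈ I, x * b ∈ I) (S T : B →L[𝕜] B) (hS : ∀ a b, S (a * b) = S a * S b)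
    (hT : ∀ a b, T (a * b) = T a * T b) : BanachBimodule 𝕜 B I where
  lact := (LinearMap.mkContinuous₂ (LinearMap.mk₂ 𝕜
    (fun (b : B) (x : I) => (⟨b * x, hl b x x.2⟩ : I))
    (fun _ _ _ => Subtype.ext (add_mul _ _ _)) (fun _ _ _ => Subtype.ext (smul_mul_assoc _ _ _))
    (fun _ _ _ => Subtype.ext (mul_add _ _ _)) (fun _ _ _ => Subtype.ext (mul_smul_comm _ _ _))) 1
    (fun b x => by rw [one_mul]; exact norm_mul_le b (x : B))).comp S
  ract := (LinearMap.mkContinuous₂ (LinearMap.mk₂ 𝕜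
    (fun (b : B) (x : I) => (⟨x * b, hr b x x.2⟩ : I))
    (fun _ _ _ => Subtype.ext (mul_add _ _ _)) (fun _ _ _ => Subtype.ext (mul_smul_comm _ _ _))
    (fun _ _ _ => Subtype.ext (add_mul _ _ _)) (fun _ _ _ => Subtype.ext (smul_mul_assoc _ _ _))) 1
    (fun b x => by rw [one_mul, mul_comm]; exact norm_mul_le (x : B) b)).comp T
  lact_mul a b x := Subtype.ext (by
    change S (a * b) * (x : B) = S a * (S b * x)
    rw [hS, mul_assoc])
  ract_mul a b x := Subtype.ext (by
    change (x : B) * T (a * b) = x * T a * T b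
    rw [hT, mul_assoc])
  lact_ract a b x := Subtype.ext (by
    change S a * ((x : B) * T b) = S a * x * T b
    rw [mul_assoc])

/-- The kernel of a bounded idempotent endomorphism `P` has a left identity `Φ` in its bidual:
`Φ · y = y`, that is, the value of `Φ` at the functional `x ↦ g (x * y)` is `g y`. -/
theorem IsAmenable.exists_left_identity_bidual_ker (h : IsAmenable.{v, max u v} 𝕜 B)
    (P : B →L[𝕜] B) (hPP : ∀ b, P (P b) = P b) (hP : ∀ a b, P (a * b) = P a * P b) :
    ∃ Φ : StrongDual 𝕜 (StrongDual 𝕜 P.ker), ∀ (y : P.ker) (g g' : StrongDual 𝕜 P.ker),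
      (∀ x z : P.ker, (z : B) = x * y → g' x = g z) → Φ g' = g y := by
  let M := BanachBimodule.ofIdeal P.ker (mul_mem_ker_left P hP) (mul_mem_ker_right P hP)
    P (ContinuousLinearMap.id 𝕜 B) hP fun _ _ => rfl
  obtain ⟨Φ, hΦ⟩ := h.exists_bidual_eq M (kerProjection P hPP) fun a b => Subtype.ext (by
    change a * b - P (a * b) = P a * (b - P b) + (a - P a) * b
    rw [hP]
    noncomm_ring)
  refine ⟨-Φ, fun y g g' hg => ?_⟩
  have hy := hΦ y g
  rw [kerProjection_eq_self] at hy
  have h0 : g.comp (M.lact y) = 0 := by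
    ext x
    have : M.lact y x = 0 := Subtype.ext (by
      change P (y : B) * (x : B) = 0
      rw [show P (y : B) = 0 from y.2, zero_mul])
    simp [this]
  have h1 : g.comp (M.ract y) = g' := by
    ext x
    exact (hg x (M.ract y x) rfl).symm
  rw [h0, h1, map_zero, zero_sub] at hy
  exact hy.symm

/-- In an amenable algebra, a left identity of the kernel of a bounded idempotent endomorphism is a
right identity as well. -/
theorem IsAmenable.right_identity_ker (h : IsAmenable.{v, max u v} 𝕜 B)
    (P : B →L[𝕜] B) (hPP : ∀ b, P (P b) = P b) (hP : ∀ a b, P (a * b) = P a * P b)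
    {p : B} (hp : P p = 0) (hpl : ∀ x, P x = 0 → p * x = x) {x : B} (hx : P x = 0) :
    x * p = x := by
  let M := BanachBimodule.ofIdeal P.ker (mul_mem_ker_left P hP) (mul_mem_ker_right P hP)
    (ContinuousLinearMap.id 𝕜 B) P (fun _ _ => rfl) hP
  obtain ⟨Ψ, hΨ⟩ := h.exists_bidual_eq M (kerProjection P hPP) fun a b => Subtype.ext (by
    change a * b - P (a * b) = a * (b - P b) + (a - P a) * P b
    rw [hP]
    noncomm_ring)
  have key : ∀ (y : P.ker) (g : StrongDual 𝕜 P.ker), g y = Ψ (g.comp (M.lact y)) := fun y g => by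
    have hy := hΨ y g
    rw [kerProjection_eq_self] at hy
    have h0 : g.comp (M.ract y) = 0 := by
      ext x
      have : M.ract y x = 0 := Subtype.ext (by
        change (x : B) * P (y : B) = 0
        rw [show P (y : B) = 0 from y.2, mul_zero])
      simp [this]
    rwa [h0, map_zero, sub_zero] at hy
  let p' : P.ker := ⟨p, hp⟩
  let x' : P.ker := ⟨x, hx⟩
  -- `Ψ` is evaluation at `p`, since `p` acts as the identity on `ker P`.
  have hΨp : ∀ g : StrongDual 𝕜 P.ker, Ψ g = g p' := fun g => by
    rw [key p' g]
    congr 1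
    ext z
    exact congrArg g (Subtype.ext (hpl z z.2).symm)
  have : M.lact x' p' = x' := by
    refine (SeparatingDual.eq_iff_forall_dual_eq (R := 𝕜)).2 fun g => ?_
    rw [key x' g, hΨp]
    rfl
  exact congrArg Subtype.val this

end Ideals

/-! ### Ideals of the bidual -/

section Bidual

variable {𝕜 : Type v} [RCLike 𝕜] {A : Type u} [NonUnitalNormedRing A] [NormedSpace 𝕜 A]

namespace ArensBidual

theorem ext_apply {m n : ArensBidual 𝕜 A} (h : ∀ f, toDual 𝕜 A m f = toDual 𝕜 A n f) : m = n :=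
  (toDual 𝕜 A).injective (ContinuousLinearMap.ext h)

variable [IsScalarTower 𝕜 A A] [SMulCommClass 𝕜 A A]

variable (𝕜 A) in
/-- The tautological identification of `A**` with the dual of `A*`, as a linear homeomorphism. -/
def toDualL : ArensBidual 𝕜 A ≃L[𝕜] StrongDual 𝕜 (StrongDual 𝕜 A) :=
  ContinuousLinearEquiv.refl 𝕜 (StrongDual 𝕜 (StrongDual 𝕜 A))

variable (𝕜 A) in
/-- The canonical embedding of `A` into its bidual. -/
def ofBase : A →L[𝕜] ArensBidual 𝕜 A :=
  ((toDualL 𝕜 A).symm : StrongDual 𝕜 (StrongDual 𝕜 A) →L[𝕜] ArensBidual 𝕜 A).comp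
    (inclusionInDoubleDual 𝕜 A)

theorem ofBase_mul (a b : A) : ofBase 𝕜 A (a * b) = ofBase 𝕜 A a * ofBase 𝕜 A b := rfl

theorem ofBase_injective : Function.Injective (ofBase 𝕜 A) := fun _ _ hab =>
  (SeparatingDual.eq_iff_forall_dual_eq (R := 𝕜)).2 fun f =>
    DFunLike.congr_fun (congrArg (toDual 𝕜 A) hab) f

/-- If `A**` is amenable, then the kernel of a bounded idempotent endomorphism `P` of `A**` has a
two-sided identity, provided that it is the annihilator of a set `E` of functionals. -/
theorem exists_identity_ker (h : IsAmenable 𝕜 (ArensBidual 𝕜 A))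
    (P : ArensBidual 𝕜 A →L[𝕜] ArensBidual 𝕜 A) (hPP : ∀ m, P (P m) = P m)
    (hP : ∀ m n, P (m * n) = P m * P n) (E : Set (StrongDual 𝕜 A))
    (hE : ∀ m, P m = 0 ↔ ∀ f ∈ E, toDual 𝕜 A m f = 0) :
    ∃ p, P p = 0 ∧ ∀ m, P m = 0 → p * m = m ∧ m * p = m := by
  obtain ⟨Φ, hΦ⟩ := IsAmenable.exists_left_identity_bidual_ker.{u, v} h P hPP hP
  -- Evaluation of elements of `ker P` at functionals in `A*`.
  let ev : StrongDual 𝕜 A →L[𝕜] StrongDual 𝕜 P.ker :=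
    (((toDualL 𝕜 A : ArensBidual 𝕜 A →L[𝕜] StrongDual 𝕜 (StrongDual 𝕜 A)).comp
      P.ker.subtypeL).flip)
  have hev : ∀ f (x : P.ker), ev f x = toDual 𝕜 A x f := fun _ _ => rfl
  let p : ArensBidual 𝕜 A := (toDual 𝕜 A).symm (Φ.comp ev)
  have hp : P p = 0 := (hE p).2 fun f hf => by
    have : ev f = 0 := by
      ext x
      exact (hE x).1 x.2 f hf
    change Φ (ev f) = 0
    rw [this, map_zero]
  have hpl : ∀ m, P m = 0 → p * m = m := fun m hm => ext_apply fun f => by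
    change Φ (ev (bidualMul 𝕜 A (toDual 𝕜 A m) f)) = _
    refine hΦ ⟨m, hm⟩ (ev f) _ fun x z hz => ?_
    rw [hev, hev, hz]
    rfl
  exact ⟨p, hp, fun m hm => ⟨hpl m hm,
    IsAmenable.right_identity_ker.{u, v} h P hPP hP hp hpl hm⟩⟩

/-- Central elements of `A**` belong to the first topological centre, because right multiplications
are always weak*-continuous. -/
theorem mem_firstTopologicalCenter_of_commute {p : ArensBidual 𝕜 A} (hp : ∀ n, p * n = n * p) :
    p ∈ firstTopologicalCenter 𝕜 A := by
  refine WeakDual.continuous_of_continuous_eval fun f => ?_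
  simp only [hp]
  exact WeakDual.eval_continuous (bidualMul 𝕜 A (toDual 𝕜 A p) f)

set_option maxSynthPendingDepth 3 in
/-- The bounded projection of `A**` onto a dual Banach algebra `A = E*` given by restriction
to `E`, together with the fact that `E` separates the points of `A`. -/
theorem exists_projection_of_bijective [CompleteSpace A] (E : Submodule 𝕜 (StrongDual 𝕜 A))
    (hbij : Function.Bijective fun a : A => (inclusionInDoubleDual 𝕜 A a).comp E.subtypeL) :
    ∃ R : ArensBidual 𝕜 A →L[𝕜] A,
      (∀ m, ∀ f ∈ E, f (R m) = toDual 𝕜 A m f) ∧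
      ∀ a b : A, (∀ f ∈ E, f a = f b) → a = b := by
  let res : StrongDual 𝕜 (StrongDual 𝕜 A) →L[𝕜] StrongDual 𝕜 E :=
    (ContinuousLinearMap.compL 𝕜 E (StrongDual 𝕜 A) 𝕜).flip E.subtypeL
  let e : A ≃L[𝕜] StrongDual 𝕜 E := ContinuousLinearEquiv.ofBijective
    (res.comp (inclusionInDoubleDual 𝕜 A)) (LinearMap.ker_eq_bot.2 hbij.1)
    (LinearMap.range_eq_top.2 hbij.2)
  refine ⟨(e.symm : StrongDual 𝕜 E →L[𝕜] A).comp
    (res.comp (toDualL 𝕜 A : ArensBidual 𝕜 A →L[𝕜] StrongDual 𝕜 (StrongDual 𝕜 A))),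
    fun m f hf => ?_, fun a b hab => hbij.1 (ContinuousLinearMap.ext fun f => hab f f.2)⟩
  exact DFunLike.congr_fun (e.apply_symm_apply (res (toDualL 𝕜 A m))) (⟨f, hf⟩ : E)

end ArensBidual

end Bidual

end

/-! ### Strongly Arens irregular algebras with amenable bidual -/

open ArensBidual in
theorem theorem5 {𝕜 : Type v} [RCLike 𝕜] {A : Type u} [NonUnitalNormedRing A] [NormedSpace 𝕜 A]
    [IsScalarTower 𝕜 A A] [SMulCommClass 𝕜 A A] [CompleteSpace A]
    (hA : IsLeftStronglyArensIrregular 𝕜 A) (ham : IsAmenable 𝕜 (ArensBidual 𝕜 A)) :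
    (∃ e : A, ∀ a : A, e * a = a ∧ a * e = a) ∧
      (IsDualBanachAlgebra 𝕜 A → IsReflexiveSpace 𝕜 A) := by
  have hcentral : ∀ p : ArensBidual 𝕜 A, (∀ n, p * n = n * p) → ∃ a, ofBase 𝕜 A a = p :=
    fun p hp => by
      have := mem_firstTopologicalCenter_of_commute hp
      rw [hA] at this
      exact this
  constructor
  · obtain ⟨p, -, hp⟩ := exists_identity_ker ham 0 (fun _ => rfl) (fun _ _ => (mul_zero _).symm) ∅
      (by simp)
    obtain ⟨e, rfl⟩ := hcentral p fun n => ((hp n rfl).1).trans ((hp n rfl).2).symm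
    exact ⟨e, fun a => ⟨ofBase_injective (𝕜 := 𝕜) (hp (ofBase 𝕜 A a) rfl).1,
      ofBase_injective (𝕜 := 𝕜) (hp (ofBase 𝕜 A a) rfl).2⟩⟩
  · rintro ⟨E, -, hEmod, hbij⟩
    obtain ⟨R, hR, hsep⟩ := exists_projection_of_bijective E hbij
    have hRbase : ∀ a, R (ofBase 𝕜 A a) = a := fun a => hsep _ _ fun f hf => hR _ f hf
    have hRmul : ∀ m n, R (m * n) = R m * R n := fun m n => hsep _ _ fun f hf => by
      -- On `E`, the functional `n · f` is `a ↦ f (a * R n)`, which is again in `E`.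
      have hnf : bidualMul 𝕜 A (toDual 𝕜 A n) f =
          f.comp ((ContinuousLinearMap.mul 𝕜 A).flip (R n)) := by
        ext a
        exact (hR n _ (hEmod f hf a).1).symm
      rw [hR _ f hf, mul_apply, hnf, ← hR m _ (hEmod f hf (R n)).2]
      rfl
    let P : ArensBidual 𝕜 A →L[𝕜] ArensBidual 𝕜 A := (ofBase 𝕜 A).comp R
    have hker : ∀ m, P m = 0 ↔ R m = 0 := fun m =>
      ⟨fun h => ofBase_injective (𝕜 := 𝕜) (h.trans (map_zero _).symm),
        fun h => (congrArg (ofBase 𝕜 A) h).trans (map_zero _)⟩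
    have hPmul : ∀ m n, P (m * n) = P m * P n := fun m n =>
      (congrArg (ofBase 𝕜 A) (hRmul m n)).trans (ofBase_mul _ _)
    have hPP : ∀ m, P (P m) = P m := fun m => congrArg (ofBase 𝕜 A) (hRbase (R m))
    obtain ⟨p, hp0, hp⟩ := exists_identity_ker ham P hPP hPmul (E : Set (StrongDual 𝕜 A))
      fun m => by
        rw [hker]
        constructor
        · intro h f hf
          rw [← hR m f hf, h, map_zero]
        · intro h
          exact hsep _ _ fun f hf => by rw [hR m f hf, h f hf, map_zero]
    -- The identity of a two-sided ideal is central: `p * n = (p * n) * p = p * (n * p) = n * p`.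
    obtain ⟨a, ha⟩ := hcentral p fun n => by
      rw [← (hp (p * n) (by rw [hPmul, hp0, zero_mul])).2, mul_assoc,
        (hp (n * p) (by rw [hPmul, hp0, mul_zero])).1]
    have hpz : p = 0 := by
      rw [← hp0, ← ha]
      exact (congrArg (ofBase 𝕜 A) (hRbase a)).symm
    intro m
    refine ⟨R m, ?_⟩
    let m' : ArensBidual 𝕜 A := (toDual 𝕜 A).symm m
    have hm : m' - P m' = 0 := by
      rw [← (hp (m' - P m') (by rw [map_sub, hPP, sub_self])).1, hpz, zero_mul]
    exact (sub_eq_zero.1 hm).symm
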